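/- Let $\Pi$ be a measure on $(0,\infty)$ with $\int_0^\infty (1\wedge z)\,\Pi(dz)<\infty$ and $\Pi(0,\infty)=\infty$, put $\Phi(\lambda)=\int_0^\infty(1-e^{-\lambda z})\,\Pi(dz)$, and let $H=(H_t)_{t\ge 0}$ be the driftless subordinator with $H_0=0$ and $\mathbf E[e^{-\lambda H_t}]=e^{-t\Phi(\lambda)}$ for $t,\lambda\ge 0$. Suppose that for every $t>0$ the variable $H_t$ has a Lebesgue density; let $h(t,\cdot)\ge 0$ be a version of it with $h(t,z)=0$ for $z\le 0$. Write $$\mathbf D^\Phi_{x+}u(x)=\int_0^\infty (u(x)-u(x-s))\,\Pi(ds),\qquad \mathbf D^\Phi_{x-}u(x)=\int_0^\infty (u(x)-u(x+s))\,\Pi(ds)$$ for the right and left Marchaud-type derivatives. Then for $t>0$ and $x\in\mathbb R$ the function $y\mapsto h(t,y-x)$ is the density of $x+H_t$, and it solves $$\partial_t h=-\mathbf D^\Phi_{y+}h=-\mathbf D^\Phi_{x-}h,\qquad h(0,y-x)=\delta(y-x),$$ in the following sense. (a) Classical sense. Assume that either $h(t,\cdot)$ is locally Lipschitz on $\mathbb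 R$ for every $t>0$, or $h$ is continuous on $(0,\infty)^2$, the integral $\int_0^\infty|h(t,z)-h(t,z-s)|\,\Pi(ds)$ is bounded on compact subsets of $(0,\infty)^2$, and $(t,z)\mapsto\int_0^\infty(h(t,z)-h(t,z-s))\,\Pi(ds)$ is continuous on $(0,\infty)^2$. Then for all $t>0$ and $0<x<y$ the integrals that define $\mathbf D^\Phi_{y+}h(t,y-x)$ and $\mathbf D^\Phi_{x-}h(t,y-x)$ converge absolutely, $\tau\mapsto h(\tau,y-x)$ is differentiable at $t$, and $$\partial_t h(t,y-x)=-\mathbf D^\Phi_{y+}h(t,y-x)=-\mathbf D^\Phi_{x-}h(t,y-x).$$ (b) Sense of distributions, without any regularity of $h$. For all $\varphi\in C_c^\infty(\mathbb R)$, $t>0$ and $x,y\in\mathbb R$, $$\frac{d}{dt}\int\varphi(y)h(t,y-x)\,dy=-\int \mathbf D^\Phi_{y-}\varphi(y)\,h(t,y-x)\,dy,\qquad \frac{d}{dt}\int\varphi(x)h(t,y-x)\,dx=-\int \mathbf D^\Phi_{x+}\varphi(x)\,h(t,y-x)\,dx .$$ (c) Initial condition. For every bounded continuous $\varphi:\mathbb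 R\to\mathbb R$ and all $x,y\in\mathbb R$, as $t\downarrow 0$, $$\int\varphi(y)h(t,y-x)\,dy\to\varphi(x),\qquad \int\varphi(x)h(t,y-x)\,dx\to\varphi(y).$$ -/

import Mathlib

open MeasureTheory ProbabilityTheory Filter Set
open scoped NNReal ENNReal Topology

noncomputable section

/-- A Lévy measure of a subordinator: carried by `(0, ∞)` and integrating `1 ∧ z`. -/
structure IsSubordinatorLevyMeasure (ν : Measure ℝ) : Prop where
  null_Iic : ν (Iic 0) = 0
  lintegral_min_lt_top : ∫⁻ z in Ioi (0 : ℝ), ENNReal.ofReal (min 1 z) ∂ν < ∞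

/-- The symbol `Φ(λ) = ∫_{(0,∞)} (1 - e^{-λ z}) ν(dz)` (no killing, no drift). -/
def levySymbol (ν : Measure ℝ) (l : ℝ) : ℝ :=
  ∫ z in Ioi (0 : ℝ), (1 - Real.exp (-l * z)) ∂ν

/-- `H` is, under `P`, a subordinator started at `0`, without killing and drift, whose Lévy
measure is `ν`. -/
structure IsDriftlessSubordinator {Ω : Type*} [MeasurableSpace Ω] (P : Measure Ω)
    (H : ℝ≥0 → Ω → ℝ) (ν : Measure ℝ) : Prop where
  levy : IsSubordinatorLevyMeasure ν
  measurable : ∀ t, Measurable (H t)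
  start_zero : ∀ᵐ ω ∂P, H 0 ω = 0
  mono_paths : ∀ᵐ ω ∂P, Monotone fun t => H t ω
  rightCont_paths : ∀ᵐ ω ∂P, ∀ t, ContinuousWithinAt (fun s => H s ω) (Ici t) t
  indep_increments : HasIndepIncrements H P
  stationary_increments : ∀ s t : ℝ≥0, P.map (fun ω => H (s + t) ω - H s ω) = P.map (H t)
  laplace : ∀ (t : ℝ≥0) (l : ℝ), 0 ≤ l →
    ∫ ω, Real.exp (-l * H t ω) ∂P = Real.exp (-(t : ℝ) * levySymbol ν l)

/-- `h t` is, for every `t > 0`, a version of the Lebesgue density of `H t`, extended by zero to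
the non-positive half-line. -/
structure IsTransitionDensity {Ω : Type*} [MeasurableSpace Ω] (P : Measure Ω)
    (H : ℝ≥0 → Ω → ℝ) (h : ℝ → ℝ → ℝ) : Prop where
  measurable : ∀ t, 0 < t → Measurable (h t)
  nonneg : ∀ t, 0 < t → ∀ z, 0 ≤ h t z
  eq_zero : ∀ t, 0 < t → ∀ z ≤ 0, h t z = 0
  law : ∀ t : ℝ≥0, 0 < t →
    P.map (H t) = volume.withDensity fun z => ENNReal.ofReal (h t z)

/-- Right Marchaud-type derivative `𝐃_{x+} u (x) = ∫_{(0,∞)} (u(x) - u(x - s)) ν(ds)`. -/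
def marchaudRight (ν : Measure ℝ) (u : ℝ → ℝ) (x : ℝ) : ℝ :=
  ∫ s in Ioi (0 : ℝ), (u x - u (x - s)) ∂ν

/-- Left Marchaud-type derivative `𝐃_{x-} u (x) = ∫_{(0,∞)} (u(x) - u(x + s)) ν(ds)`. -/
def marchaudLeft (ν : Measure ℝ) (u : ℝ → ℝ) (x : ℝ) : ℝ :=
  ∫ s in Ioi (0 : ℝ), (u x - u (x + s)) ∂ν

/-- `h` is continuous on `(0,∞) × (0,∞)`, and there the Marchaud integral of `h t` converges
absolutely, locally boundedly, to a continuous function of `(t, z)`. This allows `h t` to be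
discontinuous or unbounded at the origin, as for small times of the gamma subordinator. -/
structure MarchaudRegular (ν : Measure ℝ) (h : ℝ → ℝ → ℝ) : Prop where
  continuousOn : ContinuousOn (fun p : ℝ × ℝ => h p.1 p.2) (Ioi 0 ×ˢ Ioi 0)
  bounded : ∀ K : Set (ℝ × ℝ), IsCompact K → K ⊆ Ioi 0 ×ˢ Ioi 0 →
    ∃ C : ℝ≥0, ∀ p ∈ K, ∫⁻ s in Ioi (0 : ℝ), ‖h p.1 p.2 - h p.1 (p.2 - s)‖ₑ ∂ν ≤ C
  marchaud_continuousOn :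
    ContinuousOn (fun p : ℝ × ℝ => marchaudRight ν (h p.1) p.2) (Ioi 0 ×ˢ Ioi 0)

end

/-! The coordinate `u = e^{-w}` turns the Laplace transform at the integers into the moments of
`e^{-H_t}`: the mean of `u ^ n` is `e^{-tΦ(n)}`, and `u ^ n` is an eigenfunction of `dilationDefect`
with eigenvalue `Φ(n)`. Hence the evolution equation holds for polynomials in `e^{-w}`. Since
`dilationDefect` is bounded from the `C¹` seminorm on `[0, 1]` to the sup norm, `C¹` approximation
by polynomials extends it to every `C¹` function of `e^{-w}` (`hasDerivAt_integral_comp_exp_neg`).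
Translates of compactly supported test functions have this form, which gives (b); reflection gives
the equation in `x`. Part (c) is right-continuity of paths and dominated convergence.

For (a), Fubini moves the Marchaud derivative from the test function onto `h`
(`integral_marchaudLeft_mul`). Testing with bumps of mass one around `z`, a mean value inequality in
time that is uniform in the bump gives the pointwise derivative (`MarchaudRegular.hasDerivAt`). The
locally Lipschitz case reduces to `MarchaudRegular`: `h (s + t)` averages left translates of `h t`
over the law of `H s`, so a Lipschitz constant persists to later times, and the mean of `1 ∧ H_s`,
small with `s`, controls continuity in time. -/

noncomputable section

/-! ### Comparison of `1 ∧ s` with `1 - e^{-s}`, and integrability against the Lévy measure. -/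

theorem one_sub_exp_neg_le_min (s : ℝ) : 1 - Real.exp (-s) ≤ min 1 s := by
  refine le_min ?_ ?_
  · linarith [Real.exp_pos (-s)]
  · linarith [Real.add_one_le_exp (-s)]

/-- From `e^{-s} ≤ 1 / (1 + s)`. It lets the Laplace transform at `1` control the mean of `1 ∧ H_s`.
-/
theorem min_le_two_mul_one_sub_exp_neg {s : ℝ} (hs : 0 ≤ s) :
    min 1 s ≤ 2 * (1 - Real.exp (-s)) := by
  have h1 : Real.exp (-s) * (1 + s) ≤ 1 := by
    have h2 : 1 + s ≤ Real.exp s := by linarith [Real.add_one_le_exp s]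
    calc Real.exp (-s) * (1 + s) ≤ Real.exp (-s) * Real.exp s := by gcongr
      _ = 1 := by rw [← Real.exp_add]; simp
  rcases le_total s 1 with h | h
  · rw [min_eq_right h]
    nlinarith [Real.exp_pos (-s)]
  · rw [min_eq_left h]
    nlinarith [Real.exp_pos (-s)]

theorem exp_neg_mem_Icc {w : ℝ} (hw : 0 ≤ w) : Real.exp (-w) ∈ Icc (0 : ℝ) 1 :=
  ⟨(Real.exp_pos _).le, Real.exp_le_one_iff.2 (by linarith)⟩

namespace IsSubordinatorLevyMeasure

variable {ν : Measure ℝ}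

theorem integrableOn_min (hν : IsSubordinatorLevyMeasure ν) :
    IntegrableOn (fun s : ℝ => min 1 s) (Ioi 0) ν := by
  refine ⟨by fun_prop, ?_⟩
  rw [hasFiniteIntegral_iff_ofReal]
  · exact hν.lintegral_min_lt_top
  · filter_upwards [ae_restrict_mem measurableSet_Ioi] with s hs
    exact le_min zero_le_one (le_of_lt hs)

theorem integrableOn_of_le_min (hν : IsSubordinatorLevyMeasure ν) {g : ℝ → ℝ}
    (hg : AEStronglyMeasurable g (ν.restrict (Ioi 0))) {C : ℝ}
    (hC : ∀ s, 0 < s → |g s| ≤ C * min 1 s) : IntegrableOn g (Ioi 0) ν := by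
  refine (hν.integrableOn_min.const_mul C).mono' hg ?_
  filter_upwards [ae_restrict_mem measurableSet_Ioi] with s hs
  exact hC s hs

theorem integrableOn_one_sub_exp (hν : IsSubordinatorLevyMeasure ν) :
    IntegrableOn (fun s : ℝ => 1 - Real.exp (-s)) (Ioi 0) ν := by
  refine hν.integrableOn_of_le_min (by fun_prop) (C := 1) fun s hs => ?_
  rw [abs_of_nonneg (by linarith [(exp_neg_mem_Icc hs.le).2]), one_mul]
  exact one_sub_exp_neg_le_min s

/-- Weighting by `1 ∧ z` makes the measure finite, and dividing by this positive weight recovers it.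
Every later use of Fubini rests on this. -/
theorem sigmaFinite_restrict (hν : IsSubordinatorLevyMeasure ν) :
    SigmaFinite (ν.restrict (Ioi 0)) := by
  set f : ℝ → ℝ≥0∞ := fun z => ENNReal.ofReal (min 1 z) with hf
  have hfm : Measurable f := by fun_prop
  have hfin : IsFiniteMeasure ((ν.restrict (Ioi 0)).withDensity f) :=
    isFiniteMeasure_withDensity hν.lintegral_min_lt_top.ne
  have hpos : ∀ᵐ z ∂ν.restrict (Ioi 0), f z ≠ 0 := by
    filter_upwards [ae_restrict_mem measurableSet_Ioi] with s hs
    simpa [hf] using hs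
  rw [← withDensity_inv_same hfm hpos (by simp [hf])]
  refine SigmaFinite.withDensity_of_ne_top ?_
  rw [ae_withDensity_iff hfm]
  filter_upwards with z hz
  simpa using hz

end IsSubordinatorLevyMeasure

/-- The generator of the subordinator in the multiplicative coordinate `u = e^{-w}`, with the
opposite sign. -/
def dilationDefect (ν : Measure ℝ) (F : ℝ → ℝ) (u : ℝ) : ℝ :=
  ∫ s in Ioi (0 : ℝ), (F u - F (u * Real.exp (-s))) ∂ν

/-! ### The generator on `C¹` functions of `u` in `[0, 1]`, and polynomial approximation. -/

section Approximation

variable {ν : Measure ℝ}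

theorem abs_sub_le_of_abs_deriv_le {F : ℝ → ℝ} (hF : ContDiff ℝ 1 F) {M : ℝ}
    (hM : ∀ u ∈ Icc (0 : ℝ) 1, |deriv F u| ≤ M) {u v : ℝ} (hu : u ∈ Icc (0 : ℝ) 1)
    (hv : v ∈ Icc (0 : ℝ) 1) : |F u - F v| ≤ M * |u - v| :=
  (convex_Icc (0 : ℝ) 1).norm_image_sub_le_of_norm_deriv_le
    (fun _ _ => (hF.differentiable one_ne_zero).differentiableAt) hM hv hu

theorem abs_sub_dilation_le {F : ℝ → ℝ} (hF : ContDiff ℝ 1 F) {M : ℝ}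
    (hM : ∀ u ∈ Icc (0 : ℝ) 1, |deriv F u| ≤ M) {u s : ℝ} (hu : u ∈ Icc (0 : ℝ) 1)
    (hs : 0 ≤ s) : |F u - F (u * Real.exp (-s))| ≤ M * (1 - Real.exp (-s)) := by
  have he := exp_neg_mem_Icc hs
  have hM0 : 0 ≤ M := (abs_nonneg _).trans (hM u hu)
  refine (abs_sub_le_of_abs_deriv_le hF hM hu
    ⟨mul_nonneg hu.1 he.1, mul_le_one₀ hu.2 he.1 he.2⟩).trans ?_
  gcongr
  rw [show u - u * Real.exp (-s) = u * (1 - Real.exp (-s)) by ring,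
    abs_of_nonneg (mul_nonneg hu.1 (by linarith [he.2]))]
  exact mul_le_of_le_one_left (by linarith [he.2]) hu.2

theorem exists_abs_deriv_le {F : ℝ → ℝ} (hF : ContDiff ℝ 1 F) :
    ∃ M, ∀ u ∈ Icc (0 : ℝ) 1, |deriv F u| ≤ M :=
  isCompact_Icc.exists_bound_of_continuousOn (hF.continuous_deriv le_rfl).continuousOn

theorem integrableOn_sub_dilation (hν : IsSubordinatorLevyMeasure ν) {F : ℝ → ℝ}
    (hF : ContDiff ℝ 1 F) {u : ℝ} (hu : u ∈ Icc (0 : ℝ) 1) :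
    IntegrableOn (fun s => F u - F (u * Real.exp (-s))) (Ioi 0) ν := by
  obtain ⟨M, hM⟩ := exists_abs_deriv_le hF
  have hc := hF.continuous
  refine (hν.integrableOn_one_sub_exp.const_mul M).mono'
    (Continuous.aestronglyMeasurable (by fun_prop)) ?_
  filter_upwards [ae_restrict_mem measurableSet_Ioi] with s hs
  exact abs_sub_dilation_le hF hM hu (le_of_lt hs)

/-- For `u ≤ 1` the dilation moves `u` by at most `1 - e^{-s}`, whose integral is `Φ(1)`. Only the
derivative of `F` enters, so `C¹` approximation of `F` approximates its defect uniformly. -/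
theorem abs_dilationDefect_le (hν : IsSubordinatorLevyMeasure ν) {F : ℝ → ℝ}
    (hF : ContDiff ℝ 1 F) {M : ℝ} (hM : ∀ u ∈ Icc (0 : ℝ) 1, |deriv F u| ≤ M) {u : ℝ}
    (hu : u ∈ Icc (0 : ℝ) 1) : |dilationDefect ν F u| ≤ M * levySymbol ν 1 := by
  have h1 := norm_integral_le_of_norm_le (hν.integrableOn_one_sub_exp.const_mul M)
    (f := fun s => F u - F (u * Real.exp (-s))) (by
      filter_upwards [ae_restrict_mem measurableSet_Ioi] with s hs
      exact abs_sub_dilation_le hF hM hu (le_of_lt hs))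
  rw [integral_const_mul] at h1
  simpa [levySymbol, dilationDefect] using h1

theorem dilationDefect_sub (hν : IsSubordinatorLevyMeasure ν) {F G : ℝ → ℝ}
    (hF : ContDiff ℝ 1 F) (hG : ContDiff ℝ 1 G) {u : ℝ} (hu : u ∈ Icc (0 : ℝ) 1) :
    dilationDefect ν (fun v => F v - G v) u = dilationDefect ν F u - dilationDefect ν G u := by
  unfold dilationDefect
  rw [← integral_sub (integrableOn_sub_dilation hν hF hu) (integrableOn_sub_dilation hν hG hu)]
  congr 1 with s
  ring

theorem dilationDefect_add (hν : IsSubordinatorLevyMeasure ν) {F G : ℝ → ℝ}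
    (hF : ContDiff ℝ 1 F) (hG : ContDiff ℝ 1 G) {u : ℝ} (hu : u ∈ Icc (0 : ℝ) 1) :
    dilationDefect ν (fun v => F v + G v) u = dilationDefect ν F u + dilationDefect ν G u := by
  unfold dilationDefect
  rw [← integral_add (integrableOn_sub_dilation hν hF hu) (integrableOn_sub_dilation hν hG hu)]
  congr 1 with s
  ring

theorem dilationDefect_monomial (n : ℕ) (a u : ℝ) :
    dilationDefect ν (fun v => a * v ^ n) u = levySymbol ν n * (a * u ^ n) := by
  unfold dilationDefect levySymbol
  rw [← integral_mul_const]
  congr 1 with s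
  simp only [mul_pow, ← Real.exp_nat_mul, mul_neg, neg_mul]
  ring

theorem measurable_dilationDefect (hν : IsSubordinatorLevyMeasure ν) {F : ℝ → ℝ}
    (hF : Continuous F) : Measurable (dilationDefect ν F) := by
  have := hν.sigmaFinite_restrict
  refine StronglyMeasurable.measurable ?_
  have h1 : StronglyMeasurable fun p : ℝ × ℝ => F p.1 - F (p.1 * Real.exp (-p.2)) :=
    Continuous.stronglyMeasurable (by fun_prop)
  exact h1.integral_prod_right' (ν := ν.restrict (Ioi 0))

theorem contDiff_polynomial_eval (p : Polynomial ℝ) : ContDiff ℝ 1 fun u => p.eval u := by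
  simpa using p.contDiff_aeval (R := ℝ) (𝕜 := ℝ) 1

theorem exists_polynomial_derivative_eq (q : Polynomial ℝ) (c : ℝ) :
    ∃ p : Polynomial ℝ, p.derivative = q ∧ p.eval 0 = c := by
  suffices h : ∃ p : Polynomial ℝ, p.derivative = q by
    obtain ⟨p, hp⟩ := h
    exact ⟨p + Polynomial.C (c - p.eval 0), by simp [hp], by simp⟩
  induction q using Polynomial.induction_on' with
  | add p q hp hq =>
    obtain ⟨p', rfl⟩ := hp
    obtain ⟨q', rfl⟩ := hq
    exact ⟨p' + q', by simp⟩
  | monomial n a =>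
    refine ⟨Polynomial.monomial (n + 1) (a / (n + 1)), ?_⟩
    rw [Polynomial.derivative_monomial]
    have : (n : ℝ) + 1 ≠ 0 := by positivity
    simp [this]

/-- Weierstrass is applied to `F'`, and the polynomial is integrated from the value `F 0`. The
interval has length one, so the same `ε` bounds the values. -/
theorem exists_polynomial_near_contDiff {F : ℝ → ℝ} (hF : ContDiff ℝ 1 F) {ε : ℝ} (hε : 0 < ε) :
    ∃ p : Polynomial ℝ, (∀ u ∈ Icc (0 : ℝ) 1, |F u - p.eval u| ≤ ε) ∧
      ∀ u ∈ Icc (0 : ℝ) 1, |deriv (fun v => F v - p.eval v) u| ≤ ε := by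
  obtain ⟨q, hq⟩ := exists_polynomial_near_of_continuousOn 0 1 (deriv F)
    (hF.continuous_deriv le_rfl).continuousOn ε hε
  obtain ⟨p, rfl, hp0⟩ := exists_polynomial_derivative_eq q (F 0)
  have hd : ∀ u ∈ Icc (0 : ℝ) 1, |deriv (fun v => F v - p.eval v) u| ≤ ε := by
    intro u hu
    rw [deriv_fun_sub (hF.differentiable one_ne_zero).differentiableAt p.differentiableAt,
      Polynomial.deriv, abs_sub_comm]
    exact (hq u hu).le
  refine ⟨p, fun u hu => ?_, hd⟩
  have hFp : ContDiff ℝ 1 fun v => F v - p.eval v := hF.sub (contDiff_polynomial_eval p)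
  have h1 := abs_sub_le_of_abs_deriv_le hFp hd hu (v := 0) (by simp)
  simp only [hp0, sub_self, sub_zero] at h1
  refine h1.trans (mul_le_of_le_one_right hε.le ?_)
  rw [abs_of_nonneg hu.1]
  exact hu.2

end Approximation

/-! ### The evolution equation tested on functions of `e^{-w}`. -/

section Flow

variable {ν : Measure ℝ} {μ : ℝ → Measure ℝ}

theorem integrable_comp_exp_neg {m : Measure ℝ} [IsFiniteMeasure m] (hm : ∀ᵐ w ∂m, 0 ≤ w)
    {G : ℝ → ℝ} (hG : Measurable G) {C : ℝ} (hC : ∀ u ∈ Icc (0 : ℝ) 1, |G u| ≤ C) :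
    Integrable (fun w => G (Real.exp (-w))) m := by
  refine Integrable.of_bound (Measurable.aestronglyMeasurable (by fun_prop)) C ?_
  filter_upwards [hm] with w hw
  exact hC _ (exp_neg_mem_Icc hw)

theorem abs_integral_comp_exp_neg_le {m : Measure ℝ} [IsProbabilityMeasure m]
    (hm : ∀ᵐ w ∂m, 0 ≤ w) {G : ℝ → ℝ} {C : ℝ} (hC : ∀ u ∈ Icc (0 : ℝ) 1, |G u| ≤ C) :
    |∫ w, G (Real.exp (-w)) ∂m| ≤ C := by
  have h1 := norm_integral_le_of_norm_le_const (μ := m) (f := fun w => G (Real.exp (-w))) (C := C)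
    (by filter_upwards [hm] with w hw; exact hC _ (exp_neg_mem_Icc hw))
  simpa using h1

theorem exists_bound_Icc {F : ℝ → ℝ} (hF : Continuous F) :
    ∃ C, ∀ u ∈ Icc (0 : ℝ) 1, |F u| ≤ C :=
  isCompact_Icc.exists_bound_of_continuousOn hF.continuousOn

theorem integrable_dilationDefect (hν : IsSubordinatorLevyMeasure ν) {m : Measure ℝ}
    [IsFiniteMeasure m] (hm : ∀ᵐ w ∂m, 0 ≤ w) {F : ℝ → ℝ} (hF : ContDiff ℝ 1 F) :
    Integrable (fun w => dilationDefect ν F (Real.exp (-w))) m := by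
  obtain ⟨M, hM⟩ := exists_abs_deriv_le hF
  exact integrable_comp_exp_neg hm (measurable_dilationDefect hν hF.continuous)
    fun u hu => abs_dilationDefect_le hν hF hM hu

theorem hasDerivAt_integral_polynomial (hν : IsSubordinatorLevyMeasure ν)
    (hprob : ∀ t, 0 < t → IsProbabilityMeasure (μ t)) (hsupp : ∀ t, 0 < t → ∀ᵐ w ∂μ t, 0 ≤ w)
    (hlap : ∀ t, 0 < t → ∀ n : ℕ,
      ∫ w, Real.exp (-(n : ℝ) * w) ∂μ t = Real.exp (-t * levySymbol ν n))
    (p : Polynomial ℝ) {t : ℝ} (ht : 0 < t) :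
    HasDerivAt (fun τ => ∫ w, p.eval (Real.exp (-w)) ∂μ τ)
      (-∫ w, dilationDefect ν (fun u => p.eval u) (Real.exp (-w)) ∂μ t) t := by
  induction p using Polynomial.induction_on' with
  | add p q hp hq =>
    have := hprob t ht
    have hval : ∫ w, dilationDefect ν (fun u => (p + q).eval u) (Real.exp (-w)) ∂μ t =
        ∫ w, dilationDefect ν (fun u => p.eval u) (Real.exp (-w)) ∂μ t +
          ∫ w, dilationDefect ν (fun u => q.eval u) (Real.exp (-w)) ∂μ t := by
      rw [← integral_add (integrable_dilationDefect hν (hsupp t ht) (contDiff_polynomial_eval p))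
        (integrable_dilationDefect hν (hsupp t ht) (contDiff_polynomial_eval q))]
      refine integral_congr_ae ?_
      filter_upwards [hsupp t ht] with w hw
      simp only [Polynomial.eval_add]
      exact dilationDefect_add hν (contDiff_polynomial_eval p) (contDiff_polynomial_eval q)
        (exp_neg_mem_Icc hw)
    rw [hval, neg_add]
    refine (hp.add hq).congr_of_eventuallyEq ?_
    filter_upwards [lt_mem_nhds ht] with τ hτ
    have := hprob τ hτ
    obtain ⟨C, hC⟩ := exists_bound_Icc (contDiff_polynomial_eval p).continuous
    obtain ⟨D, hD⟩ := exists_bound_Icc (contDiff_polynomial_eval q).continuous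
    simp only [Polynomial.eval_add, Pi.add_apply]
    exact integral_add
      (integrable_comp_exp_neg (hsupp τ hτ) p.continuous.measurable hC)
      (integrable_comp_exp_neg (hsupp τ hτ) q.continuous.measurable hD)
  | monomial n a =>
    have hexp : ∀ τ, 0 < τ → ∫ w, (Real.exp (-w)) ^ n ∂μ τ = Real.exp (-τ * levySymbol ν n) := by
      intro τ hτ
      rw [← hlap τ hτ n]
      congr 1 with w
      rw [← Real.exp_nat_mul]
      ring_nf
    simp only [Polynomial.eval_monomial, dilationDefect_monomial, integral_const_mul]
    rw [hexp t ht]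
    have h1 : HasDerivAt (fun τ : ℝ => a * Real.exp (-τ * levySymbol ν n))
        (a * (Real.exp (-t * levySymbol ν n) * (-1 * levySymbol ν n))) t :=
      (((hasDerivAt_id t).neg.mul_const _).exp).const_mul a
    refine (h1.congr_of_eventuallyEq ?_).congr_deriv (by ring)
    filter_upwards [lt_mem_nhds ht] with τ hτ
    rw [hexp τ hτ]

/-- The values for the approximating polynomials converge and their time derivatives converge
uniformly in time, so the limit may be differentiated. -/
theorem hasDerivAt_integral_comp_exp_neg (hν : IsSubordinatorLevyMeasure ν)
    (hprob : ∀ t, 0 < t → IsProbabilityMeasure (μ t)) (hsupp : ∀ t, 0 < t → ∀ᵐ w ∂μ t, 0 ≤ w)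
    (hlap : ∀ t, 0 < t → ∀ n : ℕ,
      ∫ w, Real.exp (-(n : ℝ) * w) ∂μ t = Real.exp (-t * levySymbol ν n))
    {F : ℝ → ℝ} (hF : ContDiff ℝ 1 F) {t : ℝ} (ht : 0 < t) :
    HasDerivAt (fun τ => ∫ w, F (Real.exp (-w)) ∂μ τ)
      (-∫ w, dilationDefect ν F (Real.exp (-w)) ∂μ t) t := by
  choose p hp hp' using fun n : ℕ =>
    exists_polynomial_near_contDiff hF (Nat.one_div_pos_of_nat (n := n) (α := ℝ))
  have hlim : Tendsto (fun n : ℕ => 1 / ((n : ℝ) + 1)) atTop (𝓝 0) :=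
    tendsto_one_div_add_atTop_nhds_zero_nat
  obtain ⟨C, hC⟩ := exists_bound_Icc hF.continuous
  refine hasDerivAt_of_tendstoUniformlyOn (l := atTop) (s := Ioi 0) isOpen_Ioi
    (f := fun n τ => ∫ w, (p n).eval (Real.exp (-w)) ∂μ τ)
    (f' := fun n τ => -∫ w, dilationDefect ν (fun u => (p n).eval u) (Real.exp (-w)) ∂μ τ)
    (g' := fun τ => -∫ w, dilationDefect ν F (Real.exp (-w)) ∂μ τ)
    ?_ (Eventually.of_forall fun n τ hτ =>
      hasDerivAt_integral_polynomial hν hprob hsupp hlap (p n) hτ) (fun τ hτ => ?_) ht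
  · rw [Metric.tendstoUniformlyOn_iff]
    intro ε hε
    have h2 : Tendsto (fun n : ℕ => 1 / ((n : ℝ) + 1) * levySymbol ν 1) atTop (𝓝 0) := by
      simpa using hlim.mul_const (levySymbol ν 1)
    filter_upwards [h2.eventually (gt_mem_nhds hε)] with n hn τ hτ
    have := hprob τ hτ
    refine lt_of_le_of_lt ?_ hn
    rw [dist_comm, Real.dist_eq, neg_sub_neg, ← integral_sub
      (integrable_dilationDefect hν (hsupp τ hτ) hF)
      (integrable_dilationDefect hν (hsupp τ hτ) (contDiff_polynomial_eval (p n)))]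
    refine abs_integral_comp_exp_neg_le (hsupp τ hτ)
      (G := fun u => dilationDefect ν F u - dilationDefect ν (fun u => (p n).eval u) u)
      fun u hu => ?_
    rw [← dilationDefect_sub hν hF (contDiff_polynomial_eval (p n)) hu]
    exact abs_dilationDefect_le hν (hF.sub (contDiff_polynomial_eval (p n))) (hp' n) hu
  · have := hprob τ hτ
    rw [tendsto_iff_dist_tendsto_zero]
    refine squeeze_zero (fun _ => dist_nonneg) (fun n => ?_) hlim
    obtain ⟨D, hD⟩ := exists_bound_Icc (contDiff_polynomial_eval (p n)).continuous
    rw [dist_comm, Real.dist_eq, ← integral_sub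
      (integrable_comp_exp_neg (hsupp τ hτ) hF.continuous.measurable hC)
      (integrable_comp_exp_neg (hsupp τ hτ) (p n).continuous.measurable hD)]
    exact abs_integral_comp_exp_neg_le (hsupp τ hτ) (G := fun u => F u - (p n).eval u) (hp n)

end Flow

/-! ### Test functions in the coordinate `e^{-w}`. -/

/-- The candidate is `φ (x - log u)`, extended by zero. Small `u` means large `w`, where `φ`
vanishes, so the singularity of the logarithm at `0` is harmless. -/
theorem exists_contDiff_comp_exp_neg {φ : ℝ → ℝ} (hφ : ContDiff ℝ 1 φ)
    (hsupp : HasCompactSupport φ) (x : ℝ) :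
    ∃ F : ℝ → ℝ, ContDiff ℝ 1 F ∧ ∀ w, F (Real.exp (-w)) = φ (x + w) := by
  obtain ⟨R, hR⟩ := hsupp.isCompact.isBounded.subset_closedBall 0
  have hzero : ∀ y, R < y → φ y = 0 := fun y hy => by
    by_contra hne
    have h1 := hR (subset_tsupport φ hne)
    rw [mem_closedBall_zero_iff, Real.norm_eq_abs] at h1
    linarith [le_abs_self y]
  refine ⟨fun u => if u ≤ 0 then 0 else φ (x - Real.log u), ?_, fun w => ?_⟩
  · rw [contDiff_iff_contDiffAt]
    intro u
    rcases lt_or_ge 0 u with hu | hu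
    · have hlog : ContDiffAt ℝ 1 (fun v => x - Real.log v) u :=
        contDiffAt_const.sub (Real.contDiffAt_log.2 hu.ne')
      refine (hφ.contDiffAt.comp u hlog).congr_of_eventuallyEq ?_
      filter_upwards [lt_mem_nhds hu] with v hv
      simp [not_le.2 hv]
    · refine (contDiffAt_const (c := (0 : ℝ))).congr_of_eventuallyEq ?_
      -- Below `e^{x - R}` the argument `x - log v` exceeds `R`, beyond the support of `φ`.
      filter_upwards [gt_mem_nhds (hu.trans_lt (Real.exp_pos (x - R)))] with v hv
      split_ifs with hv0
      · rfl
      · refine hzero _ ?_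
        have := (Real.log_lt_iff_lt_exp (not_le.1 hv0)).2 hv
        linarith
  · simp [Real.exp_pos]

theorem dilationDefect_comp_exp_neg {ν : Measure ℝ} {F φ : ℝ → ℝ} {x : ℝ}
    (hF : ∀ w, F (Real.exp (-w)) = φ (x + w)) (w : ℝ) :
    dilationDefect ν F (Real.exp (-w)) = marchaudLeft ν φ (x + w) := by
  unfold dilationDefect marchaudLeft
  congr 1 with s
  rw [← Real.exp_add, ← neg_add, hF, hF, add_assoc]

theorem withDensity_map_const_add (f : ℝ → ℝ≥0∞) (x : ℝ) :
    (volume.withDensity f).map (fun w => x + w) = volume.withDensity fun y => f (y - x) := by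
  ext s hs
  have hm : Measurable fun w : ℝ => x + w := by fun_prop
  rw [Measure.map_apply hm hs, withDensity_apply _ (hm hs), withDensity_apply _ hs,
    ← lintegral_indicator (hm hs), ← lintegral_indicator hs,
    ← lintegral_add_left_eq_self (s.indicator fun y => f (y - x)) x]
  congr 1 with w
  by_cases hw : x + w ∈ s <;> simp [indicator, hw]

variable {Ω : Type*} [MeasurableSpace Ω] {P : Measure Ω} {H : ℝ≥0 → Ω → ℝ} {ν : Measure ℝ}
  {h : ℝ → ℝ → ℝ}

theorem IsDriftlessSubordinator.ae_nonneg (hH : IsDriftlessSubordinator P H ν) (t : ℝ≥0) :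
    ∀ᵐ w ∂P.map (H t), 0 ≤ w := by
  rw [ae_map_iff (hH.measurable t).aemeasurable measurableSet_Ici]
  filter_upwards [hH.start_zero, hH.mono_paths] with ω h0 hmono
  rw [← h0]
  exact hmono (zero_le : 0 ≤ t)

theorem IsDriftlessSubordinator.integral_map_exp (hH : IsDriftlessSubordinator P H ν) (t : ℝ≥0)
    {l : ℝ} (hl : 0 ≤ l) :
    ∫ w, Real.exp (-l * w) ∂P.map (H t) = Real.exp (-(t : ℝ) * levySymbol ν l) := by
  rw [integral_map (hH.measurable t).aemeasurable
    (Continuous.aestronglyMeasurable (by fun_prop)), hH.laplace t l hl]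

/-! ### The equations in the sense of distributions, and the initial condition. -/

namespace IsTransitionDensity

theorem map_toNNReal (hh : IsTransitionDensity P H h) {t : ℝ} (ht : 0 < t) :
    P.map (H t.toNNReal) = volume.withDensity fun z => ENNReal.ofReal (h t z) := by
  have := hh.law t.toNNReal (Real.toNNReal_pos.2 ht)
  rwa [Real.coe_toNNReal t ht.le] at this

theorem integral_map (hh : IsTransitionDensity P H h) {t : ℝ} (ht : 0 < t) (g : ℝ → ℝ) :
    ∫ w, g w ∂P.map (H t.toNNReal) = ∫ w, g w * h t w := by
  rw [hh.map_toNNReal ht, integral_withDensity_eq_integral_toReal_smul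
    (hh.measurable t ht).ennreal_ofReal (by simp)]
  congr 1 with w
  rw [ENNReal.toReal_ofReal (hh.nonneg t ht w), smul_eq_mul, mul_comm]

theorem integral_mul_translate (hh : IsTransitionDensity P H h) {t : ℝ} (ht : 0 < t)
    (g : ℝ → ℝ) (x : ℝ) :
    ∫ y, g y * h t (y - x) = ∫ w, g (x + w) ∂P.map (H t.toNNReal) := by
  rw [hh.integral_map ht fun w => g (x + w), ← integral_add_left_eq_self _ x]
  simp

theorem integrable [IsProbabilityMeasure P] (hh : IsTransitionDensity P H h)
    (hH : IsDriftlessSubordinator P H ν) {t : ℝ} (ht : 0 < t) : Integrable (h t) := by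
  refine ⟨(hh.measurable t ht).aestronglyMeasurable, ?_⟩
  rw [hasFiniteIntegral_iff_ofReal (ae_of_all _ (hh.nonneg t ht))]
  have h1 : P.map (H t.toNNReal) univ = 1 :=
    have := Measure.isProbabilityMeasure_map (μ := P) (hH.measurable t.toNNReal).aemeasurable
    measure_univ
  rw [hh.map_toNNReal ht, withDensity_apply _ MeasurableSet.univ, Measure.restrict_univ] at h1
  rw [h1]
  exact ENNReal.one_lt_top

theorem map_const_add (hH : IsDriftlessSubordinator P H ν) (hh : IsTransitionDensity P H h)
    (t : ℝ≥0) (x : ℝ) (ht : 0 < t) :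
    P.map (fun ω => x + H t ω) =
      volume.withDensity fun y => ENNReal.ofReal (h t (y - x)) := by
  have h1 := withDensity_map_const_add (fun z => ENNReal.ofReal (h t z)) x
  rw [← h1, ← hh.law t ht, Measure.map_map (by fun_prop) (hH.measurable t)]
  rfl

theorem hasDerivAt_integral_forward [IsProbabilityMeasure P] (hH : IsDriftlessSubordinator P H ν)
    (hh : IsTransitionDensity P H h) {φ : ℝ → ℝ} (hφ : ContDiff ℝ 1 φ)
    (hsupp : HasCompactSupport φ) {t : ℝ} (ht : 0 < t) (x : ℝ) :
    HasDerivAt (fun τ => ∫ y, φ y * h τ (y - x))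
      (-∫ y, marchaudLeft ν φ y * h t (y - x)) t := by
  obtain ⟨F, hF, hFφ⟩ := exists_contDiff_comp_exp_neg hφ hsupp x
  have h1 := hasDerivAt_integral_comp_exp_neg (μ := fun t : ℝ => P.map (H t.toNNReal)) hH.levy
    (fun t _ => Measure.isProbabilityMeasure_map (hH.measurable t.toNNReal).aemeasurable)
    (fun t _ => hH.ae_nonneg t.toNNReal)
    (fun t ht n => by
      rw [hH.integral_map_exp _ n.cast_nonneg, Real.coe_toNNReal t ht.le]) hF ht
  simp only [dilationDefect_comp_exp_neg hFφ, hFφ] at h1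
  rw [hh.integral_mul_translate ht]
  refine h1.congr_of_eventuallyEq ?_
  filter_upwards [lt_mem_nhds ht] with τ hτ
  exact hh.integral_mul_translate hτ φ x

/-- The reflection `x ↦ -x` exchanges the two Marchaud derivatives and reduces this to the forward
equation. -/
theorem hasDerivAt_integral_backward [IsProbabilityMeasure P]
    (hH : IsDriftlessSubordinator P H ν) (hh : IsTransitionDensity P H h) {φ : ℝ → ℝ}
    (hφ : ContDiff ℝ 1 φ) (hsupp : HasCompactSupport φ) {t : ℝ} (ht : 0 < t) (y : ℝ) :
    HasDerivAt (fun τ => ∫ x, φ x * h τ (y - x))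
      (-∫ x, marchaudRight ν φ x * h t (y - x)) t := by
  have h1 := hasDerivAt_integral_forward hH hh (φ := fun x => φ (-x)) (hφ.comp contDiff_neg)
    (hsupp.comp_homeomorph (Homeomorph.neg ℝ)) ht (-y)
  have h2 : ∀ x, marchaudLeft ν (fun x => φ (-x)) (-x) = marchaudRight ν φ x := fun x => by
    simp only [marchaudLeft, marchaudRight, neg_neg, neg_add, sub_eq_add_neg]
  convert h1 using 1
  · ext τ
    rw [← integral_neg_eq_self]
    congr 1 with x
    ring_nf
  · rw [← integral_neg_eq_self]
    congr 2 with x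
    rw [← h2]
    ring_nf

theorem tendsto_integral_forward [IsProbabilityMeasure P] (hH : IsDriftlessSubordinator P H ν)
    (hh : IsTransitionDensity P H h) {φ : ℝ → ℝ} (hφ : Continuous φ) {C : ℝ}
    (hC : ∀ z, |φ z| ≤ C) (x : ℝ) :
    Tendsto (fun t => ∫ y, φ y * h t (y - x)) (𝓝[>] 0) (𝓝 (φ x)) := by
  have h1 : Tendsto (fun t : ℝ => ∫ ω, φ (x + H t.toNNReal ω) ∂P) (𝓝[>] 0)
      (𝓝 (∫ _, φ x ∂P)) := by
    refine tendsto_integral_filter_of_dominated_convergence (fun _ => C)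
      (Eventually.of_forall fun t => ?_)
      (Eventually.of_forall fun t => ae_of_all _ fun ω => hC _) (integrable_const C) ?_
    · have := hH.measurable t.toNNReal
      exact Measurable.aestronglyMeasurable (by fun_prop)
    · filter_upwards [hH.start_zero, hH.rightCont_paths] with ω h0 hrc
      have h2 : Tendsto (fun t : ℝ => t.toNNReal) (𝓝[>] 0) (𝓝[≥] (0 : ℝ≥0)) := by
        refine tendsto_nhdsWithin_iff.2 ⟨?_, Eventually.of_forall fun t => mem_Ici.2 zero_le⟩
        have := (continuous_real_toNNReal.tendsto 0).mono_left
          (nhdsWithin_le_nhds (s := Ioi (0 : ℝ)))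
        simpa using this
      have h3 : Tendsto (fun t : ℝ => H t.toNNReal ω) (𝓝[>] 0) (𝓝 0) := by
        have := (hrc 0).tendsto.comp h2
        rwa [h0] at this
      have h4 := (hφ.tendsto (x + 0)).comp (h3.const_add x)
      simpa [Function.comp_def] using h4
  simp only [integral_const, probReal_univ, one_smul] at h1
  refine h1.congr' ?_
  filter_upwards [self_mem_nhdsWithin] with t ht
  rw [hh.integral_mul_translate ht, MeasureTheory.integral_map
    (hH.measurable _).aemeasurable (Continuous.aestronglyMeasurable (by fun_prop))]

theorem tendsto_integral_backward [IsProbabilityMeasure P] (hH : IsDriftlessSubordinator P H ν)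
    (hh : IsTransitionDensity P H h) {φ : ℝ → ℝ} (hφ : Continuous φ) {C : ℝ}
    (hC : ∀ z, |φ z| ≤ C) (y : ℝ) :
    Tendsto (fun t => ∫ x, φ x * h t (y - x)) (𝓝[>] 0) (𝓝 (φ y)) := by
  have h1 := tendsto_integral_forward hH hh (hφ.comp continuous_neg) (fun z => hC (-z)) (-y)
  simp only [Function.comp_apply, neg_neg] at h1
  refine h1.congr fun t => ?_
  rw [← integral_neg_eq_self]
  congr 1 with x
  ring_nf

end IsTransitionDensity

/-! ### Adjointness of the two Marchaud derivatives. -/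

theorem exists_abs_sub_shift_le_min {φ : ℝ → ℝ} (hφ : ContDiff ℝ 1 φ)
    (hsupp : HasCompactSupport φ) :
    ∃ C, ∀ y s : ℝ, 0 ≤ s → |φ y - φ (y + s)| ≤ C * min 1 s := by
  obtain ⟨L, hL⟩ := hφ.lipschitzWith_of_hasCompactSupport hsupp one_ne_zero
  obtain ⟨B, hB⟩ := hsupp.exists_bound_of_continuous hφ.continuous
  have hB0 : 0 ≤ B := (norm_nonneg _).trans (hB 0)
  refine ⟨max L (2 * B), fun y s hs => ?_⟩
  rcases le_total s 1 with h | h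
  · rw [min_eq_right h]
    have h1 := hL.dist_le_mul y (y + s)
    rw [Real.dist_eq, dist_self_add_right, Real.norm_of_nonneg hs] at h1
    refine h1.trans ?_
    gcongr
    exact le_max_left _ _
  · rw [min_eq_left h, mul_one]
    refine (abs_sub _ _).trans (le_trans ?_ (le_max_right _ _))
    have h1 := hB y
    have h2 := hB (y + s)
    rw [Real.norm_eq_abs] at h1 h2
    linarith

theorem measurable_marchaudRight {ν : Measure ℝ} (hν : IsSubordinatorLevyMeasure ν) {f : ℝ → ℝ}
    (hf : Measurable f) : Measurable (marchaudRight ν f) := by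
  have := hν.sigmaFinite_restrict
  have h1 : StronglyMeasurable fun p : ℝ × ℝ => f p.1 - f (p.1 - p.2) :=
    Measurable.stronglyMeasurable (by fun_prop)
  exact (h1.integral_prod_right' (ν := ν.restrict (Ioi 0))).measurable

/-- The right Marchaud derivative is the formal adjoint of the left one. -/
theorem integral_marchaudLeft_mul {ν : Measure ℝ} (hν : IsSubordinatorLevyMeasure ν)
    {φ f : ℝ → ℝ} (hφ : ContDiff ℝ 1 φ) (hsupp : HasCompactSupport φ) (hfm : Measurable f)
    (hf : Integrable f) {C : ℝ≥0}
    (hC : ∀ y ∈ tsupport φ, ∫⁻ s in Ioi (0 : ℝ), ‖f y - f (y - s)‖ₑ ∂ν ≤ C) :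
    ∫ y, marchaudLeft ν φ y * f y = ∫ y, φ y * marchaudRight ν f y := by
  have := hν.sigmaFinite_restrict
  have hφc := hφ.continuous
  obtain ⟨A, hA⟩ := exists_abs_sub_shift_le_min hφ hsupp
  obtain ⟨B, hB⟩ := hsupp.exists_bound_of_continuous hφ.continuous
  have hinteg1 : Integrable (Function.uncurry fun y s => (φ y - φ (y + s)) * f y)
      (volume.prod (ν.restrict (Ioi 0))) := by
    refine ((hf.norm.mul_prod hν.integrableOn_min).const_mul A).mono'
      (Measurable.aestronglyMeasurable (by unfold Function.uncurry; fun_prop)) ?_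
    have hpos : ∀ᵐ p : ℝ × ℝ ∂volume.prod (ν.restrict (Ioi 0)), 0 < p.2 :=
      Measure.quasiMeasurePreserving_snd.ae (ae_restrict_mem measurableSet_Ioi)
    filter_upwards [hpos] with p hp
    simp only [Function.uncurry, norm_mul]
    calc ‖φ p.1 - φ (p.1 + p.2)‖ * ‖f p.1‖ ≤ (A * min 1 p.2) * ‖f p.1‖ := by
          gcongr
          exact hA _ _ hp.le
      _ = A * (‖f p.1‖ * min 1 p.2) := by ring
  -- Here smoothness of `φ` gives nothing: the bound `hC` on `f` is used on the support of `φ`, and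
  -- elsewhere the integrand is zero.
  have hinteg2 : Integrable (Function.uncurry fun y s => φ y * (f y - f (y - s)))
      (volume.prod (ν.restrict (Ioi 0))) := by
    refine ⟨Measurable.aestronglyMeasurable (by unfold Function.uncurry; fun_prop), ?_⟩
    rw [HasFiniteIntegral, lintegral_prod _ (by unfold Function.uncurry; fun_prop)]
    have hle : ∀ y, ∫⁻ s in Ioi (0 : ℝ), ‖φ y * (f y - f (y - s))‖ₑ ∂ν ≤ ‖φ y‖ₑ * C := fun y => by
      simp only [enorm_mul]
      rw [lintegral_const_mul _ (by fun_prop)]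
      by_cases hy : y ∈ tsupport φ
      · gcongr
        exact hC y hy
      · simp [image_eq_zero_of_notMem_tsupport hy]
    refine (lintegral_mono hle).trans_lt ?_
    rw [lintegral_mul_const _ (by fun_prop)]
    exact ENNReal.mul_lt_top (hφc.integrable_of_hasCompactSupport hsupp).2 ENNReal.coe_lt_top
  have hshift : ∀ s, ∫ y, (φ y - φ (y + s)) * f y = ∫ y, φ y * (f y - f (y - s)) := fun s => by
    have i1 : Integrable fun y => φ y * f y :=
      hf.bdd_mul hφc.aestronglyMeasurable (ae_of_all _ hB)
    have i2 : Integrable fun y => φ (y + s) * f y :=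
      hf.bdd_mul (Continuous.aestronglyMeasurable (by fun_prop)) (ae_of_all _ fun y => hB (y + s))
    have i3 : Integrable fun y => φ y * f (y - s) :=
      (hf.comp_sub_right s).bdd_mul hφc.aestronglyMeasurable (ae_of_all _ hB)
    simp only [sub_mul, mul_sub]
    rw [integral_sub i1 i2, integral_sub i1 i3,
      ← integral_add_right_eq_self (fun y => φ y * f (y - s)) s]
    simp
  calc ∫ y, marchaudLeft ν φ y * f y
      = ∫ y, ∫ s in Ioi (0 : ℝ), (φ y - φ (y + s)) * f y ∂ν := by
        simp only [marchaudLeft, integral_mul_const]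
    _ = ∫ s in Ioi (0 : ℝ), (∫ y, (φ y - φ (y + s)) * f y) ∂ν := integral_integral_swap hinteg1
    _ = ∫ s in Ioi (0 : ℝ), (∫ y, φ y * (f y - f (y - s))) ∂ν := by simp only [hshift]
    _ = ∫ y, ∫ s in Ioi (0 : ℝ), φ y * (f y - f (y - s)) ∂ν := (integral_integral_swap hinteg2).symm
    _ = ∫ y, φ y * marchaudRight ν f y := by simp only [marchaudRight, integral_const_mul]

/-- An average stays within `δ` of `c` if the averaged values do. Integrability of `g` is not
needed, since `g` is bounded wherever `φ ≠ 0`. -/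
theorem abs_integral_mul_sub_le {φ g : ℝ → ℝ} (hφ : Integrable φ) (hφ0 : ∀ y, 0 ≤ φ y)
    (hφ1 : ∫ y, φ y = 1) (hg : AEStronglyMeasurable g) {c δ : ℝ}
    (hδ : ∀ y, φ y ≠ 0 → |g y - c| ≤ δ) : |(∫ y, φ y * g y) - c| ≤ δ := by
  have hb : ∀ y, ‖φ y * (g y - c)‖ ≤ φ y * δ := fun y => by
    rcases eq_or_ne (φ y) 0 with h | h
    · simp [h]
    · rw [norm_mul, Real.norm_of_nonneg (hφ0 y)]
      exact mul_le_mul_of_nonneg_left (hδ y h) (hφ0 y)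
  have hi : Integrable fun y => φ y * (g y - c) :=
    (hφ.mul_const δ).mono' (hφ.1.mul (hg.sub aestronglyMeasurable_const)) (ae_of_all _ hb)
  have h1 : (∫ y, φ y * g y) = (∫ y, φ y * (g y - c)) + c := by
    calc (∫ y, φ y * g y) = ∫ y, (φ y * (g y - c) + φ y * c) := by congr 1 with y; ring
      _ = _ := by rw [integral_add hi (hφ.mul_const c), integral_mul_const, hφ1, one_mul]
  rw [h1, add_sub_cancel_right]
  refine (norm_integral_le_of_norm_le (hφ.mul_const δ) (ae_of_all _ hb)).trans ?_
  rw [integral_mul_const, hφ1, one_mul]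

/-! ### From the distributional to the pointwise equation. -/

namespace MarchaudRegular

theorem integrableOn (hreg : MarchaudRegular ν h) (hh : IsTransitionDensity P H h) {t z : ℝ}
    (ht : 0 < t) (hz : 0 < z) : IntegrableOn (fun s => h t z - h t (z - s)) (Ioi 0) ν := by
  have hm := hh.measurable t ht
  refine ⟨Measurable.aestronglyMeasurable (by fun_prop), ?_⟩
  obtain ⟨C, hC⟩ := hreg.bounded {(t, z)} isCompact_singleton
    (by simpa using ⟨ht, hz⟩)
  exact (hC (t, z) rfl).trans_lt ENNReal.coe_lt_top

theorem hasDerivAt_integral [IsProbabilityMeasure P] (hreg : MarchaudRegular ν h)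
    (hH : IsDriftlessSubordinator P H ν) (hh : IsTransitionDensity P H h) {φ : ℝ → ℝ}
    (hφ : ContDiff ℝ 1 φ) (hsupp : HasCompactSupport φ) (hpos : tsupport φ ⊆ Ioi 0) {t : ℝ}
    (ht : 0 < t) :
    HasDerivAt (fun τ => ∫ y, φ y * h τ y) (-∫ y, φ y * marchaudRight ν (h t) y) t := by
  obtain ⟨C, hC⟩ := hreg.bounded ({t} ×ˢ tsupport φ) (isCompact_singleton.prod hsupp.isCompact)
    (prod_mono (by simpa using ht) hpos)
  rw [← integral_marchaudLeft_mul hH.levy hφ hsupp (hh.measurable t ht) (hh.integrable hH ht)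
    (C := C) fun y hy => hC (t, y) ⟨rfl, hy⟩]
  simpa using hh.hasDerivAt_integral_forward hH hφ hsupp ht 0

/-- Near `t`, bump averages of `h` around `z` have time derivative close to the claimed one, by
continuity of the Marchaud integral. The resulting increment bound does not depend on the bump,
which can then shrink to the point `z`. -/
theorem hasDerivAt [IsProbabilityMeasure P] (hreg : MarchaudRegular ν h)
    (hH : IsDriftlessSubordinator P H ν) (hh : IsTransitionDensity P H h) {t z : ℝ}
    (ht : 0 < t) (hz : 0 < z) :
    HasDerivAt (fun τ => h τ z) (-marchaudRight ν (h t) z) t := by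
  have hopen : ∀ {τ y : ℝ}, 0 < τ → 0 < y → Ioi (0 : ℝ) ×ˢ Ioi (0 : ℝ) ∈ 𝓝 (τ, y) :=
    fun hτ hy => prod_mem_nhds (Ioi_mem_nhds hτ) (Ioi_mem_nhds hy)
  rw [hasDerivAt_iff_isLittleO, Asymptotics.isLittleO_iff]
  intro c hc
  obtain ⟨δ, hδ, hball⟩ := Metric.eventually_nhds_iff.1 <|
    ((hreg.marchaud_continuousOn.continuousAt (hopen ht hz)).eventually
      (Metric.closedBall_mem_nhds _ hc)).and (hopen ht hz)
  have hD : ∀ τ y, |τ - t| < δ → |y - z| < δ →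
      |marchaudRight ν (h τ) y - marchaudRight ν (h t) z| ≤ c ∧ 0 < τ ∧ 0 < y :=
    fun τ y hτ hy => hball (y := (τ, y)) (max_lt hτ hy)
  have hcont : ∀ τ, 0 < τ → ContinuousAt (h τ) z := fun τ hτ =>
    (hreg.continuousOn.continuousAt (hopen hτ hz)).comp (f := fun y => (τ, y)) (by fun_prop)
  filter_upwards [Metric.ball_mem_nhds t hδ] with τ hτ
  have hτ0 : 0 < τ := (hD τ z hτ (by simpa using hδ)).2.1
  -- The slack `η` pays for replacing averages by point values at the two times `τ` and `t`; the
  -- bump may depend on `τ` and `η` because `δ` does not.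
  refine le_of_forall_pos_le_add fun η hη => ?_
  obtain ⟨r, hr, hrη⟩ := Metric.eventually_nhds_iff.1 <|
    ((hcont τ hτ0).eventually (Metric.closedBall_mem_nhds _ (half_pos hη))).and
      ((hcont t ht).eventually (Metric.closedBall_mem_nhds _ (half_pos hη)))
  have hρ : 0 < min r δ / 2 := half_pos (lt_min hr hδ)
  let b : ContDiffBump z := ⟨min r δ / 4, min r δ / 2, by linarith, by linarith⟩
  set φ : ℝ → ℝ := b.normed volume with hφ_def
  have hφ0 : ∀ y, 0 ≤ φ y := b.nonneg_normed
  have hφ1 : ∫ y, φ y = 1 := b.integral_normed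
  have hφi : Integrable φ := b.integrable_normed
  have hts : ∀ y ∈ tsupport φ, |y - z| < r ∧ |y - z| < δ := fun y hy => by
    rw [hφ_def, b.tsupport_normed_eq, Metric.mem_closedBall, Real.dist_eq] at hy
    have hy' : |y - z| ≤ min r δ / 2 := hy
    have hlt : |y - z| < min r δ := by linarith
    exact lt_min_iff.1 hlt
  have hnz : ∀ y, φ y ≠ 0 → |y - z| < r ∧ |y - z| < δ := fun y hy =>
    hts y (subset_tsupport φ hy)
  have hpos : tsupport φ ⊆ Ioi 0 := fun y hy => (hD t y (by simpa using hδ) (hts y hy).2).2.2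
  have happ1 : |(∫ y, φ y * h τ y) - h τ z| ≤ η / 2 :=
    abs_integral_mul_sub_le hφi hφ0 hφ1 (hh.measurable τ hτ0).aestronglyMeasurable
      fun y hy => (hrη (hnz y hy).1).1
  have happ2 : |(∫ y, φ y * h t y) - h t z| ≤ η / 2 :=
    abs_integral_mul_sub_le hφi hφ0 hφ1 (hh.measurable t ht).aestronglyMeasurable
      fun y hy => (hrη (hnz y hy).1).2
  -- Adding the linear term subtracts the expected slope, leaving a function of time with derivative
  -- at most `c` in absolute value.
  have hmv : ‖((∫ y, φ y * h τ y) + τ * marchaudRight ν (h t) z) -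
      ((∫ y, φ y * h t y) + t * marchaudRight ν (h t) z)‖ ≤ c * ‖τ - t‖ := by
    refine Convex.norm_image_sub_le_of_norm_hasDerivWithin_le
      (f := fun τ => (∫ y, φ y * h τ y) + τ * marchaudRight ν (h t) z)
      (f' := fun τ => (-∫ y, φ y * marchaudRight ν (h τ) y) + 1 * marchaudRight ν (h t) z)
      (s := Metric.ball t δ) (fun σ hσ => ?_) (fun σ hσ => ?_) (convex_ball t δ)
      (Metric.mem_ball_self hδ) hτ
    · have hσ0 : 0 < σ := (hD σ z hσ (by simpa using hδ)).2.1
      exact ((hreg.hasDerivAt_integral hH hh b.contDiff_normed b.hasCompactSupport_normed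
        hpos hσ0).add ((hasDerivAt_id σ).mul_const _)).hasDerivWithinAt
    · have hσ0 : 0 < σ := (hD σ z hσ (by simpa using hδ)).2.1
      rw [one_mul, neg_add_eq_sub, norm_sub_rev, Real.norm_eq_abs]
      exact abs_integral_mul_sub_le hφi hφ0 hφ1
        (measurable_marchaudRight hH.levy (hh.measurable σ hσ0)).aestronglyMeasurable
        fun y hy => (hD σ y hσ (hnz y hy).2).1
  rw [Real.norm_eq_abs] at hmv ⊢
  rw [smul_eq_mul]
  have h1 := abs_le.1 happ1
  have h2 := abs_le.1 happ2
  have h3 := abs_le.1 hmv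
  rw [abs_le]
  constructor <;> nlinarith [h1.1, h1.2, h2.1, h2.2, h3.1, h3.2]

end MarchaudRegular

/-! ### The convolution semigroup and the locally Lipschitz case. -/

theorem IsDriftlessSubordinator.map_add [IsProbabilityMeasure P]
    (hH : IsDriftlessSubordinator P H ν) (s t : ℝ≥0) :
    P.map (H (s + t)) = P.map (H s) ∗ P.map (H t) := by
  have hind := hH.indep_increments.indepFun_eval_sub (zero_le : 0 ≤ s)
    (le_self_add : s ≤ s + t) hH.start_zero
  have h1 := hind.map_add_eq_map_conv_map (hH.measurable s)
    ((hH.measurable (s + t)).sub (hH.measurable s))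
  have h2 : P.map (H (s + t) - H s) = P.map (H t) := hH.stationary_increments s t
  rwa [add_sub_cancel, h2] at h1

theorem IsDriftlessSubordinator.integral_min_le [IsProbabilityMeasure P]
    (hH : IsDriftlessSubordinator P H ν) (t : ℝ≥0) :
    ∫ w, min 1 w ∂P.map (H t) ≤ 2 * (1 - Real.exp (-(t : ℝ) * levySymbol ν 1)) := by
  have := Measure.isProbabilityMeasure_map (μ := P) (hH.measurable t).aemeasurable
  have hi : Integrable (fun w : ℝ => Real.exp (-w)) (P.map (H t)) :=
    integrable_comp_exp_neg (hH.ae_nonneg t) (G := id) measurable_id (C := 1) fun u hu => by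
      rw [id, abs_of_nonneg hu.1]
      exact hu.2
  have h1 := hH.integral_map_exp t zero_le_one
  simp only [neg_mul, one_mul] at h1
  calc ∫ w, min 1 w ∂P.map (H t) ≤ ∫ w, 2 * (1 - Real.exp (-w)) ∂P.map (H t) := by
        refine integral_mono_of_nonneg ?_ (((integrable_const 1).sub hi).const_mul 2) ?_
        · filter_upwards [hH.ae_nonneg t] with w hw
          exact le_min zero_le_one hw
        · filter_upwards [hH.ae_nonneg t] with w hw
          exact min_le_two_mul_one_sub_exp_neg hw
    _ = _ := by
        rw [integral_const_mul, integral_sub (integrable_const 1) hi, h1]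
        simp

namespace IsTransitionDensity

theorem ae_eq_integral [IsProbabilityMeasure P] (hH : IsDriftlessSubordinator P H ν)
    (hh : IsTransitionDensity P H h) {s t : ℝ} (hs : 0 < s) (ht : 0 < t) :
    h (s + t) =ᵐ[volume] fun z => ∫ w, h t (z - w) ∂P.map (H s.toNNReal) := by
  have hst := add_pos hs ht
  have hms := (hh.measurable s hs).ennreal_ofReal
  have hmt := (hh.measurable t ht).ennreal_ofReal
  have h1 := hH.map_add s.toNNReal t.toNNReal
  rw [← Real.toNNReal_add hs.le ht.le, hh.map_toNNReal hs, hh.map_toNNReal ht,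
    hh.map_toNNReal hst, conv_withDensity_eq_lconvolution hms hmt,
    withDensity_eq_iff_of_sigmaFinite (hh.measurable _ hst).ennreal_ofReal.aemeasurable
      (measurable_lconvolution volume hms hmt).aemeasurable] at h1
  filter_upwards [h1] with z hz
  have hm : Measurable fun w => h t (z - w) := (hh.measurable t ht).comp (by fun_prop)
  rw [integral_eq_lintegral_of_nonneg_ae (ae_of_all _ fun w => hh.nonneg t ht _)
    hm.aestronglyMeasurable, hh.map_toNNReal hs,
    lintegral_withDensity_eq_lintegral_mul _ hms hm.ennreal_ofReal,
    ← ENNReal.toReal_ofReal (hh.nonneg _ hst z), hz, lconvolution_def]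
  congr 2 with w
  simp [sub_eq_neg_add]

theorem apply_max_zero (hh : IsTransitionDensity P H h) {t : ℝ} (ht : 0 < t) (z : ℝ) :
    h t (max z 0) = h t z := by
  rcases le_total z 0 with hz | hz
  · rw [max_eq_right hz, hh.eq_zero t ht z hz, hh.eq_zero t ht 0 le_rfl]
  · rw [max_eq_left hz]

/-- Since `h t` vanishes on the negative half-line, it factors through `z ↦ max z 0`, and a
Lipschitz constant on a compact interval serves the whole half-line. -/
theorem exists_lipschitzOnWith_Iic (hh : IsTransitionDensity P H h) {t : ℝ} (ht : 0 < t)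
    (hlip : LocallyLipschitz (h t)) (R : ℝ) : ∃ L, LipschitzOnWith L (h t) (Iic R) := by
  obtain ⟨L, hL⟩ := LocallyLipschitzOn.exists_lipschitzOnWith_of_compact
    (isCompact_Icc (a := (0 : ℝ)) (b := max R 0)) hlip.locallyLipschitzOn
  refine ⟨L, LipschitzOnWith.of_dist_le_mul fun z hz z' hz' => ?_⟩
  rw [← hh.apply_max_zero ht z, ← hh.apply_max_zero ht z']
  refine (hL.dist_le_mul _ ⟨le_max_right _ _, max_le_max_right 0 hz⟩ _
    ⟨le_max_right _ _, max_le_max_right 0 hz'⟩).trans ?_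
  gcongr
  exact abs_max_sub_max_le_abs z z' 0

theorem integrable_comp_sub [IsProbabilityMeasure P] (hH : IsDriftlessSubordinator P H ν)
    (hh : IsTransitionDensity P H h) {t : ℝ} (ht : 0 < t) (hlip : LocallyLipschitz (h t))
    (s : ℝ≥0) (z : ℝ) : Integrable (fun w => h t (z - w)) (P.map (H s)) := by
  have := Measure.isProbabilityMeasure_map (μ := P) (hH.measurable s).aemeasurable
  obtain ⟨B, hB⟩ := isCompact_Icc.exists_bound_of_continuousOn (s := Icc 0 (max z 0))
    hlip.continuous.continuousOn
  have hm : Measurable fun w => h t (z - w) := (hh.measurable t ht).comp (by fun_prop)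
  refine Integrable.of_bound hm.aestronglyMeasurable B ?_
  filter_upwards [hH.ae_nonneg s] with w hw
  rw [← hh.apply_max_zero ht]
  exact hB _ ⟨le_max_right _ _, max_le_max_right 0 (by linarith)⟩

/-- As `H s ≥ 0`, the average involves only translates that stay in `Iic R`, so the constant is
preserved. -/
theorem lipschitzOnWith_integral [IsProbabilityMeasure P] (hH : IsDriftlessSubordinator P H ν)
    (hh : IsTransitionDensity P H h) {t : ℝ} (ht : 0 < t) (hlip : LocallyLipschitz (h t))
    (s : ℝ≥0) {R : ℝ} {L : ℝ≥0} (hL : LipschitzOnWith L (h t) (Iic R)) :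
    LipschitzOnWith L (fun z => ∫ w, h t (z - w) ∂P.map (H s)) (Iic R) := by
  have := Measure.isProbabilityMeasure_map (μ := P) (hH.measurable s).aemeasurable
  refine LipschitzOnWith.of_dist_le_mul fun z hz z' hz' => ?_
  rw [Real.dist_eq, ← integral_sub (hh.integrable_comp_sub hH ht hlip s z)
    (hh.integrable_comp_sub hH ht hlip s z')]
  have h1 := norm_integral_le_of_norm_le_const (μ := P.map (H s))
    (f := fun w => h t (z - w) - h t (z' - w)) (C := L * dist z z') (by
      filter_upwards [hH.ae_nonneg s] with w hw
      have h2 := hL.dist_le_mul (z - w) (mem_Iic.2 (by linarith [mem_Iic.1 hz]))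
        (z' - w) (mem_Iic.2 (by linarith [mem_Iic.1 hz']))
      rwa [dist_sub_right, Real.dist_eq] at h2)
  simpa using h1

/-- The two sides agree almost everywhere and are continuous on an open half-line around `z`. -/
theorem eq_integral [IsProbabilityMeasure P] (hH : IsDriftlessSubordinator P H ν)
    (hh : IsTransitionDensity P H h) (hlip : ∀ t, 0 < t → LocallyLipschitz (h t)) {s t : ℝ}
    (hs : 0 < s) (ht : 0 < t) (z : ℝ) :
    h (s + t) z = ∫ w, h t (z - w) ∂P.map (H s.toNNReal) := by
  obtain ⟨L, hL⟩ := hh.exists_lipschitzOnWith_Iic ht (hlip t ht) (z + 1)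
  exact Measure.eqOn_open_of_ae_eq (μ := volume) (U := Iio (z + 1))
    (ae_restrict_of_ae (ae_eq_integral hH hh hs ht)) isOpen_Iio
    (hlip _ (add_pos hs ht)).continuous.continuousOn
    ((hh.lipschitzOnWith_integral hH ht (hlip t ht) s.toNNReal hL).continuousOn.mono
      Iio_subset_Iic_self) (by simp : z ∈ Iio (z + 1))

/-- The Lipschitz constant of the density at one time serves all later times. -/
theorem exists_lipschitzOnWith_of_le [IsProbabilityMeasure P] (hH : IsDriftlessSubordinator P H ν)
    (hh : IsTransitionDensity P H h) (hlip : ∀ t, 0 < t → LocallyLipschitz (h t)) {t₀ : ℝ}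
    (ht₀ : 0 < t₀) (R : ℝ) : ∃ L, ∀ t, t₀ ≤ t → LipschitzOnWith L (h t) (Iic R) := by
  obtain ⟨L, hL⟩ := hh.exists_lipschitzOnWith_Iic ht₀ (hlip t₀ ht₀) R
  refine ⟨L, fun t ht => ?_⟩
  rcases ht.eq_or_lt with rfl | hlt
  · exact hL
  · have h1 := hh.lipschitzOnWith_integral hH ht₀ (hlip t₀ ht₀) (t - t₀).toNNReal hL
    simpa only [← hh.eq_integral hH hlip (sub_pos.2 hlt) ht₀, sub_add_cancel] using h1

theorem exists_abs_sub_le_min [IsProbabilityMeasure P] (hH : IsDriftlessSubordinator P H ν)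
    (hh : IsTransitionDensity P H h) (hlip : ∀ t, 0 < t → LocallyLipschitz (h t)) {t₀ : ℝ}
    (ht₀ : 0 < t₀) (R : ℝ) :
    ∃ C : ℝ≥0, ∀ t, t₀ ≤ t → ∀ z ≤ R, ∀ w, 0 ≤ w → |h t z - h t (z - w)| ≤ C * min 1 w := by
  obtain ⟨L, hL⟩ := hh.exists_lipschitzOnWith_of_le hH hlip ht₀ (max R 0)
  -- The summand `1` serves `w ≤ 1`; for `w ≥ 1` the positive parts of `z` and `z - w` differ by at
  -- most `max R 0`.
  refine ⟨L * (1 + (max R 0).toNNReal), fun t ht z hz w hw => ?_⟩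
  have ht0 := ht₀.trans_le ht
  have hR := le_max_right R 0
  rw [← hh.apply_max_zero ht0 z, ← hh.apply_max_zero ht0 (z - w)]
  refine ((hL t ht).dist_le_mul _ (mem_Iic.2 (max_le_max_right 0 hz)) _
    (mem_Iic.2 (max_le_max_right 0 (by linarith)))).trans ?_
  rw [NNReal.coe_mul, NNReal.coe_add, NNReal.coe_one, Real.coe_toNNReal _ hR, mul_assoc]
  gcongr
  have h1 : dist (max z 0) (max (z - w) 0) ≤ w := by
    refine (abs_max_sub_max_le_abs z (z - w) 0).trans ?_
    rw [sub_sub_cancel, abs_of_nonneg hw]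
  rcases le_total w 1 with h | h
  · rw [min_eq_right h]
    nlinarith
  · rw [min_eq_left h, mul_one, Real.dist_eq, abs_of_nonneg
      (sub_nonneg.2 (max_le_max_right 0 (by linarith)))]
    linarith [max_le_max_right 0 hz, le_max_right (z - w) 0]

/-- By the semigroup identity the time increment is the mean of a spatial increment over a jump
distributed as `H (t' - t)`, so it is at most `C` times the mean of `1 ∧ H`. -/
theorem abs_sub_time_le [IsProbabilityMeasure P] (hH : IsDriftlessSubordinator P H ν)
    (hh : IsTransitionDensity P H h) (hlip : ∀ t, 0 < t → LocallyLipschitz (h t)) {t t' z C : ℝ}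
    (ht : 0 < t) (htt' : t < t') (hC : ∀ w, 0 ≤ w → |h t z - h t (z - w)| ≤ C * min 1 w) :
    |h t' z - h t z| ≤ C * (2 * (1 - Real.exp (-(t' - t) * levySymbol ν 1))) := by
  have hs := sub_pos.2 htt'
  have := Measure.isProbabilityMeasure_map (μ := P)
    (hH.measurable (t' - t).toNNReal).aemeasurable
  have hC0 : 0 ≤ C := by simpa using (abs_nonneg _).trans (hC 1 zero_le_one)
  have h1 := hh.eq_integral hH hlip hs ht z
  rw [sub_add_cancel] at h1
  have h2 : h t z - h t' z = ∫ w, (h t z - h t (z - w)) ∂P.map (H (t' - t).toNNReal) := by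
    rw [integral_sub (integrable_const _) (hh.integrable_comp_sub hH ht (hlip t ht) _ z), ← h1]
    simp
  have hmin : Integrable (fun w : ℝ => min 1 w) (P.map (H (t' - t).toNNReal)) := by
    refine Integrable.of_bound (Continuous.aestronglyMeasurable (by fun_prop)) 1 ?_
    filter_upwards [hH.ae_nonneg (t' - t).toNNReal] with w hw
    rw [Real.norm_of_nonneg (le_min zero_le_one hw)]
    exact min_le_left _ _
  rw [abs_sub_comm, h2]
  refine (norm_integral_le_of_norm_le (f := fun w => h t z - h t (z - w))
    (hmin.const_mul C) ?_).trans ?_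
  · filter_upwards [hH.ae_nonneg (t' - t).toNNReal] with w hw
    exact hC w hw
  · rw [integral_const_mul]
    refine mul_le_mul_of_nonneg_left ?_ hC0
    have h3 := hH.integral_min_le (t' - t).toNNReal
    rwa [Real.coe_toNNReal _ hs.le] at h3

theorem continuousOn_of_locallyLipschitz [IsProbabilityMeasure P]
    (hH : IsDriftlessSubordinator P H ν) (hh : IsTransitionDensity P H h)
    (hlip : ∀ t, 0 < t → LocallyLipschitz (h t)) :
    ContinuousOn (fun p : ℝ × ℝ => h p.1 p.2) (Ioi 0 ×ˢ univ) := by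
  rintro ⟨t, z⟩ ⟨ht, -⟩
  replace ht : 0 < t := ht
  refine ContinuousAt.continuousWithinAt ?_
  obtain ⟨L, hL⟩ := hh.exists_lipschitzOnWith_of_le hH hlip (half_pos ht) (z + 1)
  obtain ⟨C, hC⟩ := hh.exists_abs_sub_le_min hH hlip (half_pos ht) (z + 1)
  have hz1 : z ≤ z + 1 := by linarith
  -- The earlier of the two times serves as the base; both exceed `t / 2`, so one constant `C`
  -- covers either order.
  have htime : ∀ t', t / 2 < t' →
      |h t' z - h t z| ≤ C * (2 * (1 - Real.exp (-|t' - t| * levySymbol ν 1))) := by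
    intro t' ht'
    have ht2 : t / 2 ≤ t := by linarith
    rcases lt_trichotomy t t' with hlt | rfl | hlt
    · rw [abs_of_pos (sub_pos.2 hlt)]
      exact hh.abs_sub_time_le hH hlip ht hlt (hC t ht2 z hz1)
    · simp
    · rw [abs_sub_comm, abs_sub_comm t' t, abs_of_pos (sub_pos.2 hlt)]
      exact hh.abs_sub_time_le hH hlip (by linarith) hlt (hC t' ht'.le z hz1)
  rw [ContinuousAt, tendsto_iff_dist_tendsto_zero]
  have hlim : Tendsto (fun p : ℝ × ℝ => (L : ℝ) * |p.2 - z| +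
      C * (2 * (1 - Real.exp (-|p.1 - t| * levySymbol ν 1)))) (𝓝 (t, z)) (𝓝 0) := by
    have hc : Continuous fun p : ℝ × ℝ => (L : ℝ) * |p.2 - z| +
      C * (2 * (1 - Real.exp (-|p.1 - t| * levySymbol ν 1))) := by fun_prop
    simpa using hc.tendsto (t, z)
  refine squeeze_zero' (Eventually.of_forall fun _ => dist_nonneg) ?_ hlim
  filter_upwards [prod_mem_nhds (Ioi_mem_nhds (show t / 2 < t by linarith))
    (Iio_mem_nhds (show z < z + 1 by linarith))] with p hp
  refine (dist_triangle _ (h p.1 z) _).trans (add_le_add ?_ (htime p.1 hp.1))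
  exact (hL p.1 (le_of_lt hp.1)).dist_le_mul _ (mem_Iic.2 (le_of_lt hp.2)) _ hz1

theorem marchaudRegular_of_locallyLipschitz [IsProbabilityMeasure P]
    (hH : IsDriftlessSubordinator P H ν) (hh : IsTransitionDensity P H h)
    (hlip : ∀ t, 0 < t → LocallyLipschitz (h t)) : MarchaudRegular ν h where
  continuousOn := (hh.continuousOn_of_locallyLipschitz hH hlip).mono
    (prod_mono_right (subset_univ _))
  bounded K hK hsub := by
    rcases K.eq_empty_or_nonempty with rfl | hne
    · exact ⟨0, by simp⟩
    -- The earliest time and the rightmost position in `K` yield one constant for all of `K`.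
    obtain ⟨p₀, hp₀, hmin⟩ := hK.exists_isMinOn hne continuous_fst.continuousOn
    obtain ⟨p₁, hp₁, hmax⟩ := hK.exists_isMaxOn hne continuous_snd.continuousOn
    obtain ⟨C, hC⟩ := hh.exists_abs_sub_le_min hH hlip (hsub hp₀).1 p₁.2
    have hfin := ENNReal.mul_lt_top (ENNReal.coe_lt_top (r := C)) hH.levy.lintegral_min_lt_top
    refine ⟨_, fun p hp => le_trans ?_ (ENNReal.coe_toNNReal hfin.ne).ge⟩
    rw [← lintegral_const_mul _ (by fun_prop)]
    refine setLIntegral_mono' measurableSet_Ioi fun s hs => ?_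
    rw [← ofReal_norm, ← ENNReal.ofReal_coe_nnreal, ← ENNReal.ofReal_mul C.coe_nonneg]
    exact ENNReal.ofReal_le_ofReal (hC p.1 (hmin hp) p.2 (hmax hp) s (le_of_lt hs))
  marchaud_continuousOn := by
    rintro ⟨t, z⟩ ⟨ht, hz⟩
    replace ht : 0 < t := ht
    refine ContinuousAt.continuousWithinAt ?_
    obtain ⟨C, hC⟩ := hh.exists_abs_sub_le_min hH hlip (half_pos ht) (z + 1)
    have hnhds : Ioi (t / 2) ×ˢ Iio (z + 1) ∈ 𝓝 (t, z) :=
      prod_mem_nhds (Ioi_mem_nhds (show t / 2 < t by linarith)) (Iio_mem_nhds (by linarith))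
    -- Every real `y` is needed, since `z - s` runs through the negative half-line too.
    have hc : ∀ y, ContinuousAt (fun p : ℝ × ℝ => h p.1 p.2) (t, y) := fun y =>
      (hh.continuousOn_of_locallyLipschitz hH hlip).continuousAt
        (prod_mem_nhds (Ioi_mem_nhds ht) univ_mem)
    refine continuousAt_of_dominated (bound := fun s => C * min 1 s) ?_ ?_
      (hH.levy.integrableOn_min.const_mul C) (ae_of_all _ fun s => ?_)
    · filter_upwards [hnhds] with p hp
      have hm := hh.measurable p.1 ((half_pos ht).trans hp.1)
      exact Measurable.aestronglyMeasurable (by fun_prop)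
    · filter_upwards [hnhds] with p hp
      filter_upwards [ae_restrict_mem measurableSet_Ioi] with s hs
      exact hC p.1 (le_of_lt hp.1) p.2 (le_of_lt hp.2) s (le_of_lt hs)
    · have hshift : ContinuousAt (fun p : ℝ × ℝ => (p.1, p.2 - s)) (t, z) := by fun_prop
      exact (hc z).sub ((hc (z - s)).tendsto.comp hshift)

end IsTransitionDensity

end

theorem theorem3p2 {Ω : Type*} [MeasurableSpace Ω] (P : Measure Ω) [IsProbabilityMeasure P]
    (H : ℝ≥0 → Ω → ℝ) (ν : Measure ℝ) (hH : IsDriftlessSubordinator P H ν)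
    (hinf : ν (Ioi 0) = ∞)
    (h : ℝ → ℝ → ℝ) (hh : IsTransitionDensity P H h) :
    -- `y ↦ h t (y - x)` is the density of `x + H t`
    (∀ (t : ℝ≥0) (x : ℝ), 0 < t →
      P.map (fun ω => x + H t ω) = volume.withDensity fun y => ENNReal.ofReal (h t (y - x))) ∧
    -- the two equations in the classical sense, as soon as `h` has the regularity for that
    (((∀ t, 0 < t → LocallyLipschitz (h t)) ∨ MarchaudRegular ν h) →
      ∀ t x y : ℝ, 0 < t → 0 < x → x < y →
        IntegrableOn (fun s => h t (y - x) - h t (y - s - x)) (Ioi 0) ν ∧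
        IntegrableOn (fun s => h t (y - x) - h t (y - (x + s))) (Ioi 0) ν ∧
        HasDerivAt (fun τ => h τ (y - x)) (-marchaudRight ν (fun y' => h t (y' - x)) y) t ∧
        HasDerivAt (fun τ => h τ (y - x)) (-marchaudLeft ν (fun x' => h t (y - x')) x) t) ∧
    -- the two equations in the sense of distributions, in `y` and in `x`, for any density
    (∀ φ : ℝ → ℝ, ContDiff ℝ (⊤ : ℕ∞) φ → HasCompactSupport φ →
      (∀ t x : ℝ, 0 < t →
        HasDerivAt (fun τ => ∫ y, φ y * h τ (y - x))
          (-∫ y, marchaudLeft ν φ y * h t (y - x)) t) ∧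
      (∀ t y : ℝ, 0 < t →
        HasDerivAt (fun τ => ∫ x, φ x * h τ (y - x))
          (-∫ x, marchaudRight ν φ x * h t (y - x)) t)) ∧
    -- the initial condition `δ(y - x)`, as a measure in `y` and in `x`
    (∀ φ : ℝ → ℝ, Continuous φ → (∃ C, ∀ z, |φ z| ≤ C) →
      (∀ x : ℝ, Tendsto (fun t => ∫ y, φ y * h t (y - x)) (𝓝[>] 0) (𝓝 (φ x))) ∧
      (∀ y : ℝ, Tendsto (fun t => ∫ x, φ x * h t (y - x)) (𝓝[>] 0) (𝓝 (φ y)))) := by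
  refine ⟨fun t x ht => hh.map_const_add hH t x ht, fun hreg t x y ht _ hxy => ?_,
    fun φ hφ hsupp => ?_, fun φ hφ hC => ?_⟩
  · have hreg : MarchaudRegular ν h :=
      hreg.elim (hh.marchaudRegular_of_locallyLipschitz hH) id
    have hz : 0 < y - x := sub_pos.2 hxy
    have hinteg := hreg.integrableOn hh ht hz
    have hderiv := hreg.hasDerivAt hH hh ht hz
    -- Both Marchaud derivatives become the same integral in the variable `y - x`.
    have hright : ∀ s, y - s - x = y - x - s := fun s => by ring
    have hleft : ∀ s, y - (x + s) = y - x - s := fun s => by ring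
    simp only [marchaudRight, marchaudLeft, hright, hleft]
    exact ⟨hinteg, hinteg, hderiv, hderiv⟩
  · have hφ1 : ContDiff ℝ 1 φ := hφ.of_le (by exact_mod_cast le_top)
    exact ⟨fun t x ht => hh.hasDerivAt_integral_forward hH hφ1 hsupp ht x,
      fun t y ht => hh.hasDerivAt_integral_backward hH hφ1 hsupp ht y⟩
  · obtain ⟨C, hC⟩ := hC
    exact ⟨hh.tendsto_integral_forward hH hφ hC, hh.tendsto_integral_backward hH hφ hC⟩
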